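/- Let $X$ be a digital image, that is, a set of points with a symmetric and antireflexive adjacency relation (a simple graph, possibly infinite). A $q$-simplex of $X$ is a set of $q+1$ mutually adjacent points. Assume that there is some $k$ such that $X$ contains no simplices of dimension greater than $k$. For $q\ge 0$ let $C_q(X)$ be the abelian group generated by the ordered $q$-simplices $\langle x_0,\dots,x_q\rangle$ (lists of $q+1$ mutually adjacent points) modulo the relations $\langle x_0,\dots,x_q\rangle=(-1)^\rho\langle x_{\rho(0)},\dots,x_{\rho(q)}\rangle$ for all permutations $\rho$ of $\{0,\dots,q\}$, where $(-1)^\rho$ is the sign of $\rho$. Its boundary map is $\partial\langle x_0,\dots,x_q\rangle=\sum_{i=0}^q(-1)^i\langle x_0,\dots,\widehat{x_i},\dots,x_q\rangle$ for $q\ge 1$ and zero for $q=0$; its homology $H_q(X)$ is the simplicial homology of $X$. A singular $q$-simplex $[x_0,\dots,x_q]$ is a list of $q+1$ points of $X$ any two of which are equal or adjacent (a continuous function to $X$ from the complete graph on $q+1$ ordered points). Let $\check C_q(X)$ be the free abelian group on the singular $q$-simplices, with boundary map $\partial[x_0,\dots,x_q]=\sum_{i=0}^q(-1)^i[x_0,\dots,\widehat{x_i},\dots,x_q]$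 for $q\ge 1$ and zero for $q=0$; its homology $\check H_q(X)$ is the singular homology of $X$. Let $\alpha:\check C_q(X)\to C_q(X)$ be the chain map $\alpha[x_0,\dots,x_q]=\langle x_0,\dots,x_q\rangle$, where the right side is interpreted as $0$ if $x_0,\dots,x_q$ are not distinct. Then for every $q\ge 0$ the induced homomorphism $\alpha_*:\check H_q(X)\to H_q(X)$ is an isomorphism; in particular $H_q(X)\cong\check H_q(X)$. -/

import Mathlib

open CategoryTheory

universe u

namespace DigitalImage

/-! A digital image `(X, κ)` is a set of points with a symmetric and antireflexive adjacency
relation, that is, a simple graph `G : SimpleGraph V` on the type `V` of its points. -/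

/-- A function between digital images is continuous if it sends adjacent points to points which
are equal or adjacent. -/
def Continuous {V W : Type*} (G : SimpleGraph V) (H : SimpleGraph W) (f : V → W) : Prop :=
  ∀ x y, G.Adj x y → f x = f y ∨ H.Adj (f x) (f y)

/-- A `q`-simplex of a digital image: a set of `q + 1` mutually adjacent points. -/
def IsSimplex {V : Type*} (G : SimpleGraph V) (q : ℕ) (s : Finset V) : Prop :=
  (∀ x ∈ s, ∀ y ∈ s, x ≠ y → G.Adj x y) ∧ s.card = q + 1

/-- A singular `q`-simplex `[x₀, …, x_q]`: a continuous function from `Δ^q`, the complete graph on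
`q + 1` ordered points, to the digital image. -/
def SingularSimplex {V : Type u} (G : SimpleGraph V) (q : ℕ) : Type u :=
  {x : Fin (q + 1) → V // Continuous (⊤ : SimpleGraph (Fin (q + 1))) G x}

/-- An ordered `q`-simplex `⟨x₀, …, x_q⟩`: a list of `q + 1` mutually adjacent points. -/
def OrderedSimplex {V : Type u} (G : SimpleGraph V) (q : ℕ) : Type u :=
  {x : Fin (q + 1) → V // ∀ i j, i ≠ j → G.Adj (x i) (x j)}

variable {V : Type u} {G : SimpleGraph V}

/-- `[x₀, …, x̂ᵢ, …, x_q]`. -/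
def SingularSimplex.face {q : ℕ} (x : SingularSimplex G (q + 1)) (i : Fin (q + 2)) :
    SingularSimplex G q :=
  ⟨fun j => x.1 (i.succAbove j), fun a b h =>
    x.2 _ _ (by simpa using h)⟩

/-- `⟨x₀, …, x̂ᵢ, …, x_q⟩`. -/
def OrderedSimplex.face {q : ℕ} (x : OrderedSimplex G (q + 1)) (i : Fin (q + 2)) :
    OrderedSimplex G q :=
  ⟨fun j => x.1 (i.succAbove j), fun a b h => x.2 _ _ (by simpa using h)⟩

/-- `⟨x_{ρ(0)}, …, x_{ρ(q)}⟩`. -/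
def OrderedSimplex.perm {q : ℕ} (x : OrderedSimplex G q) (ρ : Equiv.Perm (Fin (q + 1))) :
    OrderedSimplex G q :=
  ⟨fun j => x.1 (ρ j), fun a b h => x.2 _ _ (by simpa using h)⟩

/-- A singular simplex with distinct entries, seen as an ordered simplex. -/
def SingularSimplex.toOrdered {q : ℕ} (x : SingularSimplex G q) (hx : Function.Injective x.1) :
    OrderedSimplex G q :=
  ⟨x.1, fun i j h => (x.2 i j (by simpa using h)).resolve_left fun e => h (hx e)⟩

/-! ### Two combinatorial facts -/

theorem sum_sum_face_eq_zero {A : Type*} [AddCommGroup A] (n : ℕ)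
    (g : Fin (n + 3) → Fin (n + 2) → A)
    (hg : ∀ i j : Fin (n + 2), i ≤ j → g j.succ i = g i.castSucc j) :
    ∑ j : Fin (n + 3), ∑ i : Fin (n + 2), ((-1 : ℤ) ^ (j : ℕ) * (-1 : ℤ) ^ (i : ℕ)) • g j i = 0 := by
  rw [Finset.sum_comm, ← Finset.sum_product']
  let P := Fin (n + 2) × Fin (n + 3)
  let S : Finset P := {ij : P | (ij.2 : ℕ) ≤ (ij.1 : ℕ)}
  rw [Finset.univ_product_univ, ← Finset.sum_add_sum_compl S, ← eq_neg_iff_add_eq_zero,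
    ← Finset.sum_neg_distrib]
  let φ : ∀ ij : P, ij ∈ S → P := fun ij hij =>
    (Fin.castLT ij.2 (lt_of_le_of_lt (Finset.mem_filter.mp hij).right (Fin.is_lt ij.1)), ij.1.succ)
  apply Finset.sum_bij φ
  · intro ij hij
    simp_rw [S, φ, Finset.compl_filter, Finset.mem_filter_univ, Fin.val_succ,
      Fin.val_castLT] at hij ⊢
    lia
  · rintro ⟨i, j⟩ hij ⟨i', j'⟩ hij' h
    rw [Prod.mk_inj]
    exact ⟨by simpa [φ] using! congr_arg Prod.snd h,
      by simpa [φ, Fin.castSucc_castLT] using! congr_arg Fin.castSucc (congr_arg Prod.fst h)⟩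
  · rintro ⟨i', j'⟩ hij'
    simp_rw [S, Finset.compl_filter, Finset.mem_filter_univ, not_le] at hij'
    refine ⟨(j'.pred <| ?_, Fin.castSucc i'), ?_, ?_⟩
    · rintro rfl
      simp only [Fin.val_zero, not_lt_zero] at hij'
    · simpa [S] using! Nat.le_sub_one_of_lt hij'
    · simp only [φ, Fin.castLT_castSucc, Fin.succ_pred]
  · rintro ⟨i, j⟩ hij
    have h : (j : ℕ) ≤ i := by simpa [S] using! hij
    dsimp only [φ]
    rw [hg (j.castLT (lt_of_le_of_lt h i.2)) i h, ← neg_smul]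
    simp only [Fin.castSucc_castLT, Fin.val_succ, Fin.val_castLT]
    congr 1
    ring

theorem exists_perm_succAbove {n : ℕ} (ρ : Equiv.Perm (Fin (n + 1))) (i : Fin (n + 1)) :
    ∃ σ : Equiv.Perm (Fin n), (∀ j, ρ (i.succAbove j) = (ρ i).succAbove (σ j)) ∧
      ((Equiv.Perm.sign σ : ℤˣ) : ℤ) =
        (-1) ^ (i : ℕ) * (-1) ^ ((ρ i : Fin (n + 1)) : ℕ) * ((Equiv.Perm.sign ρ : ℤˣ) : ℤ) := by
  let τ : Equiv.Perm (Fin (n + 1)) := (Fin.cycleRange (ρ i)) * ρ * (Fin.cycleRange i)⁻¹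
  have hτ0 : τ 0 = 0 := by
    change Fin.cycleRange (ρ i) (ρ ((Fin.cycleRange i).symm 0)) = 0
    rw [Fin.cycleRange_symm_zero, Fin.cycleRange_self]
  obtain ⟨⟨p, σ⟩, hσ⟩ := (Equiv.Perm.decomposeFin (n := n)).symm.surjective τ
  have hp : p = 0 := by
    rw [← hτ0, ← hσ, Equiv.Perm.decomposeFin_symm_apply_zero]
  subst hp
  refine ⟨σ, fun j => ?_, ?_⟩
  · have h1 : τ j.succ = (σ j).succ := by
      rw [← hσ, Equiv.Perm.decomposeFin_symm_apply_succ, Equiv.swap_self, Equiv.refl_apply]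
    have h2 : Fin.cycleRange (ρ i) (ρ ((Fin.cycleRange i).symm j.succ)) = (σ j).succ := h1
    rw [Fin.cycleRange_symm_succ] at h2
    rw [← Fin.cycleRange_symm_succ (ρ i), ← h2, Equiv.symm_apply_apply]
  · have h : Equiv.Perm.sign τ = Equiv.Perm.sign σ := by
      rw [← hσ, Equiv.Perm.decomposeFin.symm_sign, if_pos rfl, one_mul]
    rw [← h]
    simp only [τ, map_mul, Equiv.Perm.sign_inv, Fin.sign_cycleRange]
    push_cast
    ring

/-! ### The singular chain complex -/

noncomputable section

/-- The group of singular `q`-chains: the free abelian group on the singular `q`-simplices. -/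
abbrev SingularChain (G : SimpleGraph V) (q : ℕ) : Type u := SingularSimplex G q →₀ ℤ

/-- `∂[x₀, …, x_{q+1}] = ∑ᵢ (-1)ⁱ [x₀, …, x̂ᵢ, …, x_{q+1}]`. -/
def singularBoundary (G : SimpleGraph V) (q : ℕ) :
    SingularChain G (q + 1) →ₗ[ℤ] SingularChain G q :=
  Finsupp.linearCombination ℤ fun x : SingularSimplex G (q + 1) =>
    ∑ i : Fin (q + 2), (-1 : ℤ) ^ (i : ℕ) • Finsupp.single (x.face i) (1 : ℤ)

theorem singularBoundary_single {q : ℕ} (x : SingularSimplex G (q + 1)) :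
    singularBoundary G q (Finsupp.single x 1) =
      ∑ i : Fin (q + 2), (-1 : ℤ) ^ (i : ℕ) • Finsupp.single (x.face i) (1 : ℤ) := by
  rw [singularBoundary, Finsupp.linearCombination_single, one_smul]

theorem succAbove_comm {n : ℕ} (i j : Fin (n + 2)) (h : i ≤ j) (k : Fin (n + 1)) :
    j.succ.succAbove (i.succAbove k) = i.castSucc.succAbove (j.succAbove k) :=
  congrArg (fun f => f.toOrderHom k) (SimplexCategory.δ_comp_δ h)

theorem singularBoundary_comp (G : SimpleGraph V) (q : ℕ) :
    singularBoundary G q ∘ₗ singularBoundary G (q + 1) = 0 := by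
  refine Finsupp.lhom_ext' fun x => LinearMap.ext_ring ?_
  simp only [LinearMap.comp_apply, Finsupp.lsingle_apply, LinearMap.zero_apply,
    singularBoundary_single, map_sum, map_smul, Finset.smul_sum, smul_smul]
  refine sum_sum_face_eq_zero q (fun j i => Finsupp.single ((x.face j).face i) (1 : ℤ)) ?_
  intro i j h
  have : (x.face j.succ).face i = (x.face i.castSucc).face j :=
    Subtype.ext (funext fun k => congrArg x.1 (succAbove_comm i j h k))
  simp only [this]

/-- The singular chain complex of a digital image. -/
def singularComplex (G : SimpleGraph V) : ChainComplex (ModuleCat.{u} ℤ) ℕ :=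
  ChainComplex.of (fun q => ModuleCat.of ℤ (SingularChain G q))
    (fun q => ModuleCat.ofHom (singularBoundary G q))
    fun q => by rw [← ModuleCat.ofHom_comp, singularBoundary_comp]; rfl

/-! ### The simplicial chain complex -/

/-- The subgroup generated by all `⟨x₀, …, x_q⟩ - (-1)^ρ ⟨x_{ρ(0)}, …, x_{ρ(q)}⟩`. -/
def permRelations (G : SimpleGraph V) (q : ℕ) : Submodule ℤ (OrderedSimplex G q →₀ ℤ) :=
  Submodule.span ℤ {c | ∃ (x : OrderedSimplex G q) (ρ : Equiv.Perm (Fin (q + 1))),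
    c = Finsupp.single x 1 - ((Equiv.Perm.sign ρ : ℤˣ) : ℤ) • Finsupp.single (x.perm ρ) 1}

/-- The group of simplicial `q`-chains: generated by the ordered `q`-simplices, with
`⟨x₀, …, x_q⟩` identified with `(-1)^ρ ⟨x_{ρ(0)}, …, x_{ρ(q)}⟩`. -/
abbrev SimplicialChain (G : SimpleGraph V) (q : ℕ) : Type u :=
  (OrderedSimplex G q →₀ ℤ) ⧸ permRelations G q

/-- The class of the ordered simplex `⟨x₀, …, x_q⟩` in the group of simplicial chains. -/
def OrderedSimplex.chain {q : ℕ} (x : OrderedSimplex G q) : SimplicialChain G q :=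
  (permRelations G q).mkQ (Finsupp.single x 1)

theorem OrderedSimplex.chain_perm {q : ℕ} (x : OrderedSimplex G q)
    (ρ : Equiv.Perm (Fin (q + 1))) :
    x.chain = ((Equiv.Perm.sign ρ : ℤˣ) : ℤ) • (x.perm ρ).chain := by
  rw [OrderedSimplex.chain, OrderedSimplex.chain, ← map_smul, ← sub_eq_zero, ← map_sub,
    Submodule.mkQ_apply, Submodule.Quotient.mk_eq_zero]
  exact Submodule.subset_span ⟨x, ρ, rfl⟩

theorem sign_sq {n : ℕ} (ρ : Equiv.Perm (Fin n)) :
    ((Equiv.Perm.sign ρ : ℤˣ) : ℤ) * ((Equiv.Perm.sign ρ : ℤˣ) : ℤ) = 1 := by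
  rw [← Units.val_mul, Int.units_mul_self, Units.val_one]

theorem neg_one_pow_mul_self (n : ℕ) : (-1 : ℤ) ^ n * (-1) ^ n = 1 := by
  rw [← mul_pow]; simp

theorem sum_face_perm {q : ℕ} (x : OrderedSimplex G (q + 1)) (ρ : Equiv.Perm (Fin (q + 2))) :
    ∑ i : Fin (q + 2), (-1 : ℤ) ^ (i : ℕ) • (x.face i).chain =
      ((Equiv.Perm.sign ρ : ℤˣ) : ℤ) •
        ∑ i : Fin (q + 2), (-1 : ℤ) ^ (i : ℕ) • ((x.perm ρ).face i).chain := by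
  rw [← Equiv.sum_comp ρ, Finset.smul_sum]
  refine Finset.sum_congr rfl fun i _ => ?_
  obtain ⟨σ, hσ, hs⟩ := exists_perm_succAbove ρ i
  have h : (x.perm ρ).face i = (x.face (ρ i)).perm σ :=
    Subtype.ext (funext fun k => congrArg x.1 (hσ k))
  rw [h, (x.face (ρ i)).chain_perm σ, smul_smul, smul_smul, hs]
  congr 1
  linear_combination ((-1 : ℤ) ^ (i : ℕ) * ((Equiv.Perm.sign ρ : ℤˣ) : ℤ)) *
    neg_one_pow_mul_self (ρ i : Fin (q + 2))

/-- `∂⟨x₀, …, x_{q+1}⟩ = ∑ᵢ (-1)ⁱ ⟨x₀, …, x̂ᵢ, …, x_{q+1}⟩`. -/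
def simplicialBoundary (G : SimpleGraph V) (q : ℕ) :
    SimplicialChain G (q + 1) →ₗ[ℤ] SimplicialChain G q :=
  (permRelations G (q + 1)).liftQ
    (Finsupp.linearCombination ℤ fun x : OrderedSimplex G (q + 1) =>
      ∑ i : Fin (q + 2), (-1 : ℤ) ^ (i : ℕ) • (x.face i).chain)
    (by
      rw [permRelations, Submodule.span_le]
      rintro _ ⟨x, ρ, rfl⟩
      rw [SetLike.mem_coe, LinearMap.mem_ker, map_sub, map_smul,
        Finsupp.linearCombination_single, Finsupp.linearCombination_single, one_smul, one_smul,
        sub_eq_zero]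
      exact sum_face_perm x ρ)

theorem simplicialBoundary_chain {q : ℕ} (x : OrderedSimplex G (q + 1)) :
    simplicialBoundary G q x.chain =
      ∑ i : Fin (q + 2), (-1 : ℤ) ^ (i : ℕ) • (x.face i).chain := by
  rw [simplicialBoundary, OrderedSimplex.chain, Submodule.mkQ_apply, Submodule.liftQ_apply,
    Finsupp.linearCombination_single, one_smul]

theorem simplicialBoundary_comp (G : SimpleGraph V) (q : ℕ) :
    simplicialBoundary G q ∘ₗ simplicialBoundary G (q + 1) = 0 := by
  refine Submodule.linearMap_qext _ (Finsupp.lhom_ext' fun x => LinearMap.ext_ring ?_)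
  change simplicialBoundary G q (simplicialBoundary G (q + 1) x.chain) = 0
  simp only [simplicialBoundary_chain, map_sum, map_smul, Finset.smul_sum, smul_smul]
  refine sum_sum_face_eq_zero q (fun j i => ((x.face j).face i).chain) ?_
  intro i j h
  have : (x.face j.succ).face i = (x.face i.castSucc).face j :=
    Subtype.ext (funext fun k => congrArg x.1 (succAbove_comm i j h k))
  simp only [this]

/-- The simplicial chain complex of a digital image. -/
def simplicialComplex (G : SimpleGraph V) : ChainComplex (ModuleCat.{u} ℤ) ℕ :=
  ChainComplex.of (fun q => ModuleCat.of ℤ (SimplicialChain G q))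
    (fun q => ModuleCat.ofHom (simplicialBoundary G q))
    fun q => by rw [← ModuleCat.ofHom_comp, simplicialBoundary_comp]; rfl

/-! ### The comparison chain map -/

open Classical in
/-- `⟨x₀, …, x_q⟩` for a singular simplex `[x₀, …, x_q]`, interpreted as `0` if there is a
repetition among the `xᵢ`. -/
def SingularSimplex.chain {q : ℕ} (x : SingularSimplex G q) : SimplicialChain G q :=
  if hx : Function.Injective x.1 then (x.toOrdered hx).chain else 0

/-- The homomorphism `α[x₀, …, x_q] = ⟨x₀, …, x_q⟩`. -/
def alphaMap (G : SimpleGraph V) (q : ℕ) : SingularChain G q →ₗ[ℤ] SimplicialChain G q :=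
  Finsupp.linearCombination ℤ fun x : SingularSimplex G q => x.chain

theorem alphaMap_single {q : ℕ} (x : SingularSimplex G q) :
    alphaMap G q (Finsupp.single x 1) = x.chain := by
  rw [alphaMap, Finsupp.linearCombination_single, one_smul]

theorem sum_face_chain_eq_zero {q : ℕ} (x : SingularSimplex G (q + 1))
    (hx : ¬ Function.Injective x.1) :
    ∑ i : Fin (q + 2), (-1 : ℤ) ^ (i : ℕ) • (x.face i).chain = 0 := by
  obtain ⟨a, b, hab, hne⟩ : ∃ a b, x.1 a = x.1 b ∧ a ≠ b := by
    simpa [Function.Injective] using hx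
  have hrest : ∀ i, i ≠ a ∧ i ≠ b → (-1 : ℤ) ^ (i : ℕ) • (x.face i).chain = 0 := by
    rintro i ⟨hia, hib⟩
    obtain ⟨a', rfl⟩ := Fin.exists_succAbove_eq hia.symm
    obtain ⟨b', rfl⟩ := Fin.exists_succAbove_eq hib.symm
    have : ¬ Function.Injective (x.face i).1 := fun h => hne (congrArg _ (h hab))
    rw [SingularSimplex.chain, dif_neg this, smul_zero]
  rw [Fintype.sum_eq_add a b hne hrest]
  obtain ⟨σ, hσ, hs⟩ := exists_perm_succAbove (Equiv.swap a b) a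
  have hinv : ∀ k, x.1 (Equiv.swap a b k) = x.1 k := by
    intro k
    rcases eq_or_ne k a with rfl | ha
    · rw [Equiv.swap_apply_left, hab]
    rcases eq_or_ne k b with rfl | hb
    · rw [Equiv.swap_apply_right, hab]
    · rw [Equiv.swap_apply_of_ne_of_ne ha hb]
  rw [Equiv.swap_apply_left] at hσ hs
  have hface : ∀ k, (x.face a).1 k = (x.face b).1 (σ k) := fun k => by
    change x.1 (a.succAbove k) = x.1 (b.succAbove (σ k))
    rw [← hσ, hinv]
  have hcomp : (x.face a).1 = (x.face b).1 ∘ σ := funext hface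
  by_cases hb : Function.Injective (x.face b).1
  · have ha : Function.Injective (x.face a).1 := by
      rw [hcomp]; exact hb.comp σ.injective
    have h : (x.face a).toOrdered ha = ((x.face b).toOrdered hb).perm σ :=
      Subtype.ext hcomp
    rw [SingularSimplex.chain, SingularSimplex.chain, dif_pos ha, dif_pos hb, h,
      ((x.face b).toOrdered hb).chain_perm σ, smul_smul, ← add_smul, hs,
      Equiv.Perm.sign_swap hne]
    have : (-1 : ℤ) ^ (a : ℕ) + (-1) ^ (b : ℕ) *
        ((-1) ^ (a : ℕ) * (-1) ^ (b : ℕ) * ((-1 : ℤˣ) : ℤ)) = 0 := by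
      rw [Units.val_neg, Units.val_one]
      linear_combination (-(-1 : ℤ) ^ (a : ℕ)) * neg_one_pow_mul_self b
    rw [this, zero_smul]
  · have ha : ¬ Function.Injective (x.face a).1 := by
      rw [hcomp]; exact fun h => hb ((Function.Injective.of_comp_iff' _ σ.bijective).1 h)
    rw [SingularSimplex.chain, SingularSimplex.chain, dif_neg ha, dif_neg hb, smul_zero,
      smul_zero, add_zero]

theorem alphaMap_comm (G : SimpleGraph V) (q : ℕ) :
    simplicialBoundary G q ∘ₗ alphaMap G (q + 1) = alphaMap G q ∘ₗ singularBoundary G q := by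
  refine Finsupp.lhom_ext' fun x => LinearMap.ext_ring ?_
  simp only [LinearMap.comp_apply, Finsupp.lsingle_apply, singularBoundary_single, map_sum,
    map_smul, alphaMap_single]
  by_cases hx : Function.Injective x.1
  · rw [SingularSimplex.chain, dif_pos hx, simplicialBoundary_chain]
    refine Finset.sum_congr rfl fun i _ => ?_
    have hi : Function.Injective (x.face i).1 := hx.comp (Fin.succAbove_right_injective)
    rw [SingularSimplex.chain, dif_pos hi]
    rfl
  · rw [sum_face_chain_eq_zero x hx, SingularSimplex.chain, dif_neg hx, map_zero]

/-- The chain map `α` from the singular to the simplicial chain complex. -/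
def alpha (G : SimpleGraph V) : singularComplex G ⟶ simplicialComplex G :=
  ChainComplex.ofHom (fun q => ModuleCat.ofHom (alphaMap G q)) fun q => by
    simp only [singularComplex, simplicialComplex, ChainComplex.of_d]
    rw [← ModuleCat.ofHom_comp, ← ModuleCat.ofHom_comp, alphaMap_comm]

/-- `H_q(X)`, the simplicial homology of a digital image. -/
abbrev simplicialHomology (G : SimpleGraph V) (q : ℕ) : ModuleCat.{u} ℤ :=
  (simplicialComplex G).homology q

/-- The singular homology group of a digital image in dimension `q`. -/
abbrev singularHomology (G : SimpleGraph V) (q : ℕ) : ModuleCat.{u} ℤ :=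
  (singularComplex G).homology q

end

end DigitalImage

/-!
The comparison map `α` is a chain homotopy equivalence.

Fix a linear order on the points. Listing the points of an ordered simplex in increasing order,
with the sign of the permutation which sorts them, respects the relations between ordered simplices
and so defines `sortMap : C_q(X) → Č_q(X)`. It commutes with the boundary, since every face of an
increasing list is increasing (`sortMap_comm`), and `α ∘ sortMap = id` (`alphaMap_comp_sortMap`).

In the other direction, `f = id - sortMap ∘ α` is an endomorphism of the singular complex which
vanishes in dimension `0` and sends a singular simplex `x` to a chain on the points of `x`
(`sortDefect_mem_chainsOn`). These points are mutually equal or adjacent, so that every chain on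
them has a cone with apex `x₀`, and every cycle of positive dimension is the boundary of its cone
(`singularBoundary_cone`). The recursion `h x = cone_{x₀} (f x - h (∂ x))` therefore gives
`∂ h + h ∂ = f` (`contraction_spec`): this is the method of acyclic carriers.
-/

namespace DigitalImage

noncomputable section

variable {V : Type u} {G : SimpleGraph V}

/-! ### Sorting ordered simplices -/

theorem OrderedSimplex.injective {q : ℕ} (x : OrderedSimplex G q) : Function.Injective x.1 :=
  fun i j h => by_contra fun hij => G.ne_of_adj (x.2 i j hij) h

/-- An ordered simplex, seen as a singular simplex. -/
def OrderedSimplex.toSingular {q : ℕ} (x : OrderedSimplex G q) : SingularSimplex G q :=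
  ⟨x.1, fun i j h => Or.inr (x.2 i j (by simpa using h))⟩

theorem OrderedSimplex.chain_toSingular {q : ℕ} (x : OrderedSimplex G q) :
    x.toSingular.chain = x.chain :=
  dif_pos x.injective

section Sorting

variable [LinearOrder V]

/-- The increasing list of the points of an ordered simplex, with the sign of the permutation
which sorts them. -/
def OrderedSimplex.sortChain {q : ℕ} (x : OrderedSimplex G q) : SingularChain G q :=
  ((Equiv.Perm.sign (Tuple.sort x.1) : ℤˣ) : ℤ) •
    Finsupp.single (x.perm (Tuple.sort x.1)).toSingular 1

theorem OrderedSimplex.sortChain_of_monotone {q : ℕ} (x : OrderedSimplex G q)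
    (hx : Monotone x.1) : x.sortChain = Finsupp.single x.toSingular 1 := by
  have h : Tuple.sort x.1 = 1 := Tuple.sort_eq_refl_iff_monotone.2 hx
  rw [sortChain, h, Equiv.Perm.sign_one, Units.val_one, one_smul]
  rfl

theorem OrderedSimplex.sortChain_perm {q : ℕ} (x : OrderedSimplex G q)
    (ρ : Equiv.Perm (Fin (q + 1))) :
    x.sortChain = ((Equiv.Perm.sign ρ : ℤˣ) : ℤ) • (x.perm ρ).sortChain := by
  have hf : (x.1 ∘ ρ) ∘ Tuple.sort (x.1 ∘ ρ) = x.1 ∘ Tuple.sort x.1 :=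
    Tuple.comp_perm_comp_sort_eq_comp_sort
  have hs : ρ * Tuple.sort (x.1 ∘ ρ) = Tuple.sort x.1 :=
    Equiv.ext fun i => x.injective (congrFun hf i)
  have hp : (x.perm ρ).perm (Tuple.sort (x.perm ρ).1) = x.perm (Tuple.sort x.1) :=
    Subtype.ext hf
  rw [sortChain, sortChain, hp, smul_smul, ← hs, Equiv.Perm.sign_mul, Units.val_mul]
  rfl

/-- The homomorphism from simplicial to singular chains which sorts the points of a simplex. -/
def sortMap (G : SimpleGraph V) (q : ℕ) : SimplicialChain G q →ₗ[ℤ] SingularChain G q :=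
  (permRelations G q).liftQ
    (Finsupp.linearCombination ℤ fun x : OrderedSimplex G q => x.sortChain)
    (by
      rw [permRelations, Submodule.span_le]
      rintro _ ⟨x, ρ, rfl⟩
      rw [SetLike.mem_coe, LinearMap.mem_ker, map_sub, map_smul,
        Finsupp.linearCombination_single, Finsupp.linearCombination_single, one_smul, one_smul,
        sub_eq_zero]
      exact x.sortChain_perm ρ)

theorem sortMap_chain {q : ℕ} (x : OrderedSimplex G q) : sortMap G q x.chain = x.sortChain := by
  rw [sortMap, OrderedSimplex.chain, Submodule.mkQ_apply, Submodule.liftQ_apply,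
    Finsupp.linearCombination_single, one_smul]

/-- The increasing ordered simplices generate the simplicial chains. -/
theorem simplicialChain_hom_ext {q : ℕ} {A : Type*} [AddCommGroup A]
    {f g : SimplicialChain G q →ₗ[ℤ] A}
    (h : ∀ x : OrderedSimplex G q, Monotone x.1 → f x.chain = g x.chain) : f = g := by
  refine Submodule.linearMap_qext _ (Finsupp.lhom_ext' fun x => LinearMap.ext_ring ?_)
  change f x.chain = g x.chain
  rw [x.chain_perm (Tuple.sort x.1), map_smul, map_smul, h _ (Tuple.monotone_sort x.1)]

theorem sortMap_comm (G : SimpleGraph V) (q : ℕ) :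
    singularBoundary G q ∘ₗ sortMap G (q + 1) = sortMap G q ∘ₗ simplicialBoundary G q := by
  refine simplicialChain_hom_ext fun x hx => ?_
  rw [LinearMap.comp_apply, LinearMap.comp_apply, sortMap_chain, x.sortChain_of_monotone hx,
    singularBoundary_single, simplicialBoundary_chain, map_sum]
  refine Finset.sum_congr rfl fun i _ => ?_
  rw [map_smul, sortMap_chain, OrderedSimplex.sortChain_of_monotone (x.face i)
    (hx.comp (Fin.strictMono_succAbove i).monotone)]
  rfl

theorem alphaMap_comp_sortMap (G : SimpleGraph V) (q : ℕ) :
    alphaMap G q ∘ₗ sortMap G q = LinearMap.id := by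
  refine simplicialChain_hom_ext fun x hx => ?_
  rw [LinearMap.comp_apply, sortMap_chain, x.sortChain_of_monotone hx, alphaMap_single,
    x.chain_toSingular, LinearMap.id_apply]

end Sorting

/-! ### Chains on a set of points and their cones -/

/-- The singular chains all of whose simplices have their points in `S`. -/
def chainsOn (G : SimpleGraph V) (q : ℕ) (S : Set V) : Submodule ℤ (SingularChain G q) :=
  Finsupp.supported ℤ ℤ {y : SingularSimplex G q | ∀ i, y.1 i ∈ S}

theorem single_mem_chainsOn {q : ℕ} {S : Set V} {y : SingularSimplex G q} (hy : ∀ i, y.1 i ∈ S) :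
    Finsupp.single y 1 ∈ chainsOn G q S :=
  Finsupp.single_mem_supported ℤ 1 hy

theorem chainsOn_mono {q : ℕ} {S T : Set V} (h : S ⊆ T) : chainsOn G q S ≤ chainsOn G q T :=
  Finsupp.supported_mono fun _ hy i => h (hy i)

theorem chainsOn_induction {q : ℕ} {S : Set V} {P : SingularChain G q → Prop}
    (single : ∀ y : SingularSimplex G q, (∀ i, y.1 i ∈ S) → P (Finsupp.single y 1))
    (zero : P 0) (add : ∀ a b, P a → P b → P (a + b)) (smul : ∀ (n : ℤ) a, P a → P (n • a))
    {c : SingularChain G q} (hc : c ∈ chainsOn G q S) : P c := by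
  rw [chainsOn, Finsupp.supported_eq_span_single] at hc
  refine Submodule.span_induction ?_ zero (fun a b _ _ => add a b) (fun n a _ => smul n a) hc
  rintro _ ⟨y, hy, rfl⟩
  exact single y hy

open Classical in
/-- The cone `[v, y₀, …, y_q]` with apex `v` over a singular simplex, and `0` if this list is not a
singular simplex. -/
def SingularSimplex.cone (v : V) {q : ℕ} (y : SingularSimplex G q) : SingularChain G (q + 1) :=
  if h : Continuous ⊤ G (Fin.cons v y.1 : Fin (q + 2) → V) then Finsupp.single ⟨_, h⟩ 1 else 0

/-- The linear extension of the cone with apex `v` to singular chains. -/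
def cone (G : SimpleGraph V) (v : V) (q : ℕ) : SingularChain G q →ₗ[ℤ] SingularChain G (q + 1) :=
  Finsupp.linearCombination ℤ fun y => y.cone v

theorem cone_single (v : V) {q : ℕ} (y : SingularSimplex G q) :
    cone G v q (Finsupp.single y 1) = y.cone v := by
  rw [cone, Finsupp.linearCombination_single, one_smul]

theorem SingularSimplex.eq_or_adj {q : ℕ} (x : SingularSimplex G q) (i j : Fin (q + 1)) :
    x.1 i = x.1 j ∨ G.Adj (x.1 i) (x.1 j) := by
  rcases eq_or_ne i j with rfl | h
  · exact Or.inl rfl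
  · exact x.2 i j (by simpa using h)

section Clique

variable {S : Set V} {v : V}

theorem continuous_cons (hS : ∀ a ∈ S, ∀ b ∈ S, a = b ∨ G.Adj a b) (hv : v ∈ S) {q : ℕ}
    {y : Fin (q + 1) → V} (hy : ∀ i, y i ∈ S) :
    Continuous ⊤ G (Fin.cons v y : Fin (q + 2) → V) := by
  have h : ∀ i, (Fin.cons v y : Fin (q + 2) → V) i ∈ S := Fin.cases hv hy
  exact fun i j _ => hS _ (h i) _ (h j)

theorem cone_mem_chainsOn (hv : v ∈ S) {q : ℕ} {c : SingularChain G q}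
    (hc : c ∈ chainsOn G q S) : cone G v q c ∈ chainsOn G (q + 1) S := by
  refine chainsOn_induction (P := fun c => cone G v q c ∈ chainsOn G (q + 1) S)
    (fun y hy => ?_) ?_ (fun a b ha hb => ?_) (fun n a ha => ?_) hc
  · rw [cone_single, SingularSimplex.cone]
    split_ifs
    · exact single_mem_chainsOn (Fin.cases hv hy)
    · exact zero_mem _
  · rw [map_zero]; exact zero_mem _
  · rw [map_add]; exact add_mem ha hb
  · rw [map_smul]; exact Submodule.smul_mem _ n ha

/-- Coning is a contracting homotopy, in positive dimensions, of the chains on a set of mutually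
equal or adjacent points. -/
theorem singularBoundary_cone (hS : ∀ a ∈ S, ∀ b ∈ S, a = b ∨ G.Adj a b) (hv : v ∈ S) {q : ℕ}
    {c : SingularChain G (q + 1)} (hc : c ∈ chainsOn G (q + 1) S) :
    singularBoundary G (q + 1) (cone G v (q + 1) c) = c - cone G v q (singularBoundary G q c) := by
  refine chainsOn_induction (P := fun c => singularBoundary G (q + 1) (cone G v (q + 1) c) =
    c - cone G v q (singularBoundary G q c))
    (fun y hy => ?_) ?_ (fun a b ha hb => ?_) (fun n a ha => ?_) hc
  · have hcone := continuous_cons hS hv hy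
    have hd := singularBoundary_single (⟨_, hcone⟩ : SingularSimplex G (q + 2))
    rw [Fin.sum_univ_succ] at hd
    rw [cone_single, SingularSimplex.cone, dif_pos hcone, hd, singularBoundary_single,
      map_sum, sub_eq_add_neg, ← Finset.sum_neg_distrib]
    congr 1
    · rw [Fin.val_zero, pow_zero, one_smul]
      rfl
    · refine Finset.sum_congr rfl fun i _ => ?_
      have hface := continuous_cons hS hv (y := (y.face i).1) fun j => hy _
      rw [map_smul, cone_single, SingularSimplex.cone, dif_pos hface, Fin.val_succ, pow_succ,
        mul_neg_one, neg_smul]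
      congr 3
      refine Subtype.ext (funext (Fin.cases rfl fun j => ?_))
      change (Fin.cons v y.1 : Fin (q + 3) → V) (i.succ.succAbove j.succ) = y.1 (i.succAbove j)
      rw [Fin.succ_succAbove_succ, Fin.cons_succ]
  · simp only [map_zero, sub_zero]
  · simp only [map_add, ha, hb]; abel
  · simp only [map_smul, ha, smul_sub]

end Clique

/-! ### Contracting carried endomorphisms -/

/-- The homotopy `h x = cone_{x₀} (f x - h (∂ x))`, starting from `0` in dimension `0`. -/
def contraction (f : ∀ q, SingularChain G q →ₗ[ℤ] SingularChain G q) :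
    ∀ q, SingularChain G q →ₗ[ℤ] SingularChain G (q + 1)
  | 0 => 0
  | q + 1 => Finsupp.linearCombination ℤ fun x : SingularSimplex G (q + 1) =>
      cone G (x.1 0) (q + 1)
        (f (q + 1) (Finsupp.single x 1) -
          contraction f q (singularBoundary G q (Finsupp.single x 1)))

section Contraction

variable {f : ∀ q, SingularChain G q →ₗ[ℤ] SingularChain G q}

theorem contraction_succ_single {q : ℕ} (x : SingularSimplex G (q + 1)) :
    contraction f (q + 1) (Finsupp.single x 1) =
      cone G (x.1 0) (q + 1)
        (f (q + 1) (Finsupp.single x 1) -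
          contraction f q (singularBoundary G q (Finsupp.single x 1))) := by
  rw [contraction, Finsupp.linearCombination_single, one_smul]

theorem contraction_boundary_mem {q : ℕ}
    (hh : ∀ x : SingularSimplex G q,
      contraction f q (Finsupp.single x 1) ∈ chainsOn G (q + 1) (Set.range x.1))
    (x : SingularSimplex G (q + 1)) :
    contraction f q (singularBoundary G q (Finsupp.single x 1)) ∈
      chainsOn G (q + 1) (Set.range x.1) := by
  rw [singularBoundary_single, map_sum]
  refine Submodule.sum_mem _ fun i _ => ?_
  rw [map_smul]
  refine Submodule.smul_mem _ _ (chainsOn_mono ?_ (hh (x.face i)))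
  rintro _ ⟨j, rfl⟩
  exact ⟨i.succAbove j, rfl⟩

theorem contraction_mem_chainsOn
    (hf : ∀ q (x : SingularSimplex G q), f q (Finsupp.single x 1) ∈ chainsOn G q (Set.range x.1))
    (q : ℕ) (x : SingularSimplex G q) :
    contraction f q (Finsupp.single x 1) ∈ chainsOn G (q + 1) (Set.range x.1) := by
  induction q with
  | zero => exact zero_mem _
  | succ q ih =>
    rw [contraction_succ_single]
    exact cone_mem_chainsOn (Set.mem_range_self 0) (sub_mem (hf _ x) (contraction_boundary_mem ih x))

/-- An endomorphism of the singular complex which vanishes in dimension `0` and sends each singular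
simplex to a chain on its points is null-homotopic. -/
theorem contraction_spec
    (hf : ∀ q (x : SingularSimplex G q), f q (Finsupp.single x 1) ∈ chainsOn G q (Set.range x.1))
    (hcomm : ∀ q, singularBoundary G q ∘ₗ f (q + 1) = f q ∘ₗ singularBoundary G q)
    (hzero : f 0 = 0) (q : ℕ) :
    singularBoundary G (q + 1) ∘ₗ contraction f (q + 1) +
      contraction f q ∘ₗ singularBoundary G q = f (q + 1) := by
  refine Finsupp.lhom_ext' fun x => LinearMap.ext_ring ?_
  simp only [LinearMap.comp_apply, LinearMap.add_apply, Finsupp.lsingle_apply]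
  have hmem := sub_mem (hf _ x) (contraction_boundary_mem (contraction_mem_chainsOn hf q) x)
  have hS : ∀ a ∈ Set.range x.1, ∀ b ∈ Set.range x.1, a = b ∨ G.Adj a b := by
    rintro _ ⟨i, rfl⟩ _ ⟨j, rfl⟩
    exact x.eq_or_adj i j
  have hcycle : singularBoundary G q (f (q + 1) (Finsupp.single x 1) -
      contraction f q (singularBoundary G q (Finsupp.single x 1))) = 0 := by
    rw [map_sub, sub_eq_zero]
    have hfx := LinearMap.congr_fun (hcomm q) (Finsupp.single x 1)
    rw [LinearMap.comp_apply, LinearMap.comp_apply] at hfx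
    rw [hfx]
    cases q with
    | zero => rw [hzero, contraction]; simp only [LinearMap.zero_apply, map_zero]
    | succ q =>
      have ih := LinearMap.congr_fun (contraction_spec hf hcomm hzero q)
        (singularBoundary G (q + 1) (Finsupp.single x 1))
      have hdd := LinearMap.congr_fun (singularBoundary_comp G q) (Finsupp.single x 1)
      rw [LinearMap.comp_apply, LinearMap.zero_apply] at hdd
      rw [LinearMap.add_apply, LinearMap.comp_apply, LinearMap.comp_apply, hdd, map_zero,
        add_zero] at ih
      exact ih.symm
  rw [contraction_succ_single, singularBoundary_cone hS (Set.mem_range_self 0) hmem, hcycle,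
    map_zero, sub_zero, sub_add_cancel]

end Contraction

/-! ### The homotopy equivalence -/

theorem singularComplex_d (G : SimpleGraph V) (q : ℕ) :
    (singularComplex G).d (q + 1) q = ModuleCat.ofHom (singularBoundary G q) := by
  simp only [singularComplex, ChainComplex.of_d]

section Equivalence

variable [LinearOrder V]

/-- The endomorphism `id - sortMap ∘ α` of the singular chains. -/
def sortDefect (G : SimpleGraph V) (q : ℕ) : SingularChain G q →ₗ[ℤ] SingularChain G q :=
  LinearMap.id - sortMap G q ∘ₗ alphaMap G q

theorem sortDefect_single {q : ℕ} (x : SingularSimplex G q) :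
    sortDefect G q (Finsupp.single x 1) = Finsupp.single x 1 - sortMap G q x.chain := by
  rw [sortDefect, LinearMap.sub_apply, LinearMap.comp_apply, alphaMap_single, LinearMap.id_apply]

theorem sortDefect_mem_chainsOn (q : ℕ) (x : SingularSimplex G q) :
    sortDefect G q (Finsupp.single x 1) ∈ chainsOn G q (Set.range x.1) := by
  rw [sortDefect_single]
  refine sub_mem (single_mem_chainsOn fun i => ⟨i, rfl⟩) ?_
  rw [SingularSimplex.chain]
  split_ifs with hx
  · rw [sortMap_chain]
    exact Submodule.smul_mem _ _ (single_mem_chainsOn fun i => ⟨_, rfl⟩)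
  · rw [map_zero]; exact zero_mem _

theorem sortDefect_comm (q : ℕ) :
    singularBoundary G q ∘ₗ sortDefect G (q + 1) = sortDefect G q ∘ₗ singularBoundary G q := by
  rw [sortDefect, sortDefect, LinearMap.comp_sub, LinearMap.sub_comp, LinearMap.comp_id,
    LinearMap.id_comp, ← LinearMap.comp_assoc, sortMap_comm, LinearMap.comp_assoc, alphaMap_comm,
    LinearMap.comp_assoc]

theorem sortDefect_zero : sortDefect G 0 = 0 := by
  refine Finsupp.lhom_ext' fun x => LinearMap.ext_ring ?_
  -- A list with one entry has no repetition and is increasing.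
  have hx : Function.Injective x.1 := fun i j _ => Subsingleton.elim (α := Fin 1) i j
  have hm : Monotone (x.toOrdered hx).1 := fun i j _ =>
    (congrArg x.1 (Subsingleton.elim (α := Fin 1) i j)).le
  rw [LinearMap.comp_apply, Finsupp.lsingle_apply, sortDefect_single, SingularSimplex.chain,
    dif_pos hx, sortMap_chain, OrderedSimplex.sortChain_of_monotone _ hm]
  exact sub_self _

/-- The chain map from the simplicial to the singular chain complex which sorts the points of a
simplex. -/
def sortHom (G : SimpleGraph V) : simplicialComplex G ⟶ singularComplex G :=
  ChainComplex.ofHom (fun q => ModuleCat.ofHom (sortMap G q)) fun q => by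
    simp only [singularComplex, simplicialComplex, ChainComplex.of_d]
    rw [← ModuleCat.ofHom_comp, ← ModuleCat.ofHom_comp, sortMap_comm]

theorem sortHom_comp_alpha (G : SimpleGraph V) : sortHom G ≫ alpha G = 𝟙 _ := by
  ext q : 1
  change ModuleCat.ofHom (sortMap G q) ≫ ModuleCat.ofHom (alphaMap G q) = _
  rw [← ModuleCat.ofHom_comp, alphaMap_comp_sortMap]
  rfl

/-- The maps `contraction (sortDefect G)`, indexed as a homotopy requires. -/
def sortContraction (G : SimpleGraph V) (i j : ℕ) (h : (ComplexShape.down ℕ).Rel j i) :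
    (singularComplex G).X i ⟶ (singularComplex G).X j :=
  ModuleCat.ofHom (contraction (sortDefect G) i) ≫
    eqToHom (congrArg (singularComplex G).X (show i + 1 = j from h))

theorem sortContraction_succ (G : SimpleGraph V) {q : ℕ}
    (h : (ComplexShape.down ℕ).Rel (q + 1) q) :
    sortContraction G q (q + 1) h = ModuleCat.ofHom (contraction (sortDefect G) q) :=
  Category.comp_id _

theorem sortContraction_comp_d (G : SimpleGraph V) {q : ℕ}
    (h : (ComplexShape.down ℕ).Rel (q + 1) q) :
    sortContraction G q (q + 1) h ≫ (singularComplex G).d (q + 1) q =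
      ModuleCat.ofHom (singularBoundary G q ∘ₗ contraction (sortDefect G) q) := by
  rw [sortContraction_succ, singularComplex_d]
  rfl

theorem d_comp_sortContraction (G : SimpleGraph V) {q : ℕ}
    (h : (ComplexShape.down ℕ).Rel (q + 1) q) :
    (singularComplex G).d (q + 1) q ≫ sortContraction G q (q + 1) h =
      ModuleCat.ofHom (contraction (sortDefect G) q ∘ₗ singularBoundary G q) := by
  rw [sortContraction_succ, singularComplex_d]
  rfl

theorem nullHomotopicMap_sortContraction (G : SimpleGraph V) :
    Homotopy.nullHomotopicMap' (sortContraction G) = 𝟙 _ - alpha G ≫ sortHom G := by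
  ext q : 1
  change _ = ModuleCat.ofHom (sortDefect G q)
  cases q with
  | zero =>
    rw [Homotopy.nullHomotopicMap'_f_of_not_rel_left (ComplexShape.down_mk 1 0 rfl)
      (fun l => by simp), sortContraction_comp_d, contraction, LinearMap.comp_zero, sortDefect_zero]
  | succ q =>
    rw [Homotopy.nullHomotopicMap'_f (ComplexShape.down_mk (q + 2) (q + 1) rfl)
      (ComplexShape.down_mk (q + 1) q rfl), sortContraction_comp_d, d_comp_sortContraction,
      ← contraction_spec sortDefect_mem_chainsOn sortDefect_comm sortDefect_zero q]
    exact congrArg ModuleCat.ofHom (add_comm _ _)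

/-- Sorting and `α` are mutually inverse up to homotopy. -/
def sortHomotopyEquiv (G : SimpleGraph V) :
    HomotopyEquiv (simplicialComplex G) (singularComplex G) where
  hom := sortHom G
  inv := alpha G
  homotopyHomInvId := Homotopy.ofEq (sortHom_comp_alpha G)
  homotopyInvHomId := (Homotopy.equivSubZero.symm
    ((Homotopy.ofEq (nullHomotopicMap_sortContraction G).symm).trans
      (Homotopy.nullHomotopy' (sortContraction G)))).symm

end Equivalence

end

end DigitalImage

theorem theorem6p2 {V : Type u} (G : SimpleGraph V)
    (hk : ∃ k : ℕ, ∀ q : ℕ, k < q → ∀ s : Finset V, ¬ DigitalImage.IsSimplex G q s) (q : ℕ) :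
    ∃ e : DigitalImage.simplicialHomology G q ≅ DigitalImage.singularHomology G q,
      e.inv = HomologicalComplex.homologyMap (DigitalImage.alpha G) q := by
  classical
  let _ : LinearOrder V := linearOrderOfSTO (WellOrderingRel (α := V))
  exact ⟨(DigitalImage.sortHomotopyEquiv G).toHomologyIso q, rfl⟩
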